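/- Consider the continuous-time switched linear system $\dot x(t)=A_{\sigma(t)}x(t)$ on $\mathbb R^n$ with modes $\mathcal Q=\{1,\dots,M\}$, $M\ge 1$, and real $n\times n$ matrices $A_1,\dots,A_M$. For a measurable $\sigma:[0,\infty)\to\mathcal Q$ and $z\in\mathbb R^n$ let $x(\cdot;z,\sigma)$ be the Carathéodory solution with $x(0)=z$. The system is *switching stabilizable* if for each $\epsilon>0$ there is $\delta>0$ such that for every $z$ with $\|z\|<\delta$ there is a measurable $\sigma$ with $\|x(t;z,\sigma)\|<\epsilon$ for all $t\ge 0$ and $x(t;z,\sigma)\to 0$ as $t\to\infty$. A *pointwise minimum piecewise quadratic function* (pm-PQF) is a function $V(x)=\min_{1\le j\le m}x^TP_jx$ with $m\ge 1$ and symmetric $P_j$ such that for each $j$ there is an $x$ with $x^TP_jx<x^TP_kx$ for all $k\ne j$. A *pm-PQCLF* of the system is a pm-PQF $V:\mathbb R^n\to[0,\infty)$ for which there is a continuous $W:\mathbb R^n\to[0,\infty)$ such that $V(x)>0$ and $W(x)>0$ for $x\ne0$, $V(0)=0$; the set $\{x:V(x)\le\beta\}$ is bounded for each $\beta$; and, for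 all $x\in\mathbb R^n$, the one-sided directional derivatives $DV(x;\eta)=\lim_{s\downarrow0}\frac1s\big(V(x+s\eta)-V(x)\big)$ exist for $\eta=A_ix$, $i\in\mathcal Q$, and $\min_{i\in\mathcal Q}DV(x;A_ix)\le -W(x)$. For $h>0$ and $N\in\mathbb N$ let $V_N^h(z)=\min_\sigma\sum_{k=0}^N\|x^h(k;z,\sigma)\|^2$ be the $N$-horizon value function of the sampled system $x(k+1)=e^{A_{\sigma(k)}h}x(k)$, where $x^h(\cdot;z,\sigma)$ is its solution with initial state $z$ under $\sigma:\mathbb N\to\mathcal Q$. **Theorem (Converse pm-PQCLF Theorem).** If the switched linear system is switching stabilizable, then it admits a pm-PQCLF. Moreover, $V_N^h$ with sufficiently small sampling period $h$ and sufficiently large horizon $N$ is such a function, in the following sense: there is $T_0>0$ such that for every $T\ge T_0$ there is $h_0>0$ such that for all $h\in(0,h_0)$ and all $N\in\mathbb N$ with $T_0\le Nh\le T$, the function $V_N^h$ is a pm-PQCLF of the system. -/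

import Mathlib

open MeasureTheory Filter Topology

noncomputable section

namespace SwitchedLinear

/-- `x` is a Caratheodory solution on `[0, ∞)` of `x' = A_{σ(t)} x`, `x(0) = z`: it is absolutely
continuous on every compact interval and satisfies the equation almost everywhere.
(The values of `σ` and `x` at negative times play no role.) -/
def IsTrajectory {n M : ℕ} (A : Fin M → Matrix (Fin n) (Fin n) ℝ) (σ : ℝ → Fin M)
    (z : EuclideanSpace ℝ (Fin n)) (x : ℝ → EuclideanSpace ℝ (Fin n)) : Prop :=
  x 0 = z ∧
  (∀ T : ℝ, 0 ≤ T → AbsolutelyContinuousOnInterval x 0 T) ∧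
  ∀ᵐ t ∂(volume.restrict (Set.Ici (0 : ℝ))),
    HasDerivAt x (Matrix.toEuclideanLin (A (σ t)) (x t)) t

/-- Switching stabilizability with measurable switching signals. -/
def SwitchingStabilizable {n M : ℕ} (A : Fin M → Matrix (Fin n) (Fin n) ℝ) : Prop :=
  ∀ ε : ℝ, 0 < ε → ∃ δ : ℝ, 0 < δ ∧ ∀ z : EuclideanSpace ℝ (Fin n), ‖z‖ < δ →
    ∃ σ : ℝ → Fin M, Measurable σ ∧ ∃ x : ℝ → EuclideanSpace ℝ (Fin n),
      IsTrajectory A σ z x ∧ (∀ t : ℝ, 0 ≤ t → ‖x t‖ < ε) ∧ Tendsto x atTop (𝓝 0)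

/-- The quadratic form `xᵀ P x`. -/
def quadForm {n : ℕ} (P : Matrix (Fin n) (Fin n) ℝ) (x : EuclideanSpace ℝ (Fin n)) : ℝ :=
  x.ofLp ⬝ᵥ P.mulVec x.ofLp

/-- `V` is a pointwise minimum piecewise quadratic function: the minimum of `m + 1` quadratic forms,
each of which is, at some point, strictly smaller than all the others. -/
def IsPMPQF {n : ℕ} (V : EuclideanSpace ℝ (Fin n) → ℝ) : Prop :=
  ∃ (m : ℕ) (P : Fin (m + 1) → Matrix (Fin n) (Fin n) ℝ),
    (∀ j, (P j).IsSymm) ∧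
    (∀ x, V x = Finset.univ.inf' Finset.univ_nonempty (fun j => quadForm (P j) x)) ∧
    ∀ j, {x | ∀ k, k ≠ j → quadForm (P j) x < quadForm (P k) x}.Nonempty

/-- The one-sided directional derivative `DV(x; η) = lim_{s ↓ 0} (V(x + s η) - V(x)) / s` exists
and equals `d`. -/
def HasDirDeriv {n : ℕ} (V : EuclideanSpace ℝ (Fin n) → ℝ) (x η : EuclideanSpace ℝ (Fin n))
    (d : ℝ) : Prop :=
  Tendsto (fun s : ℝ => (1 / s) * (V (x + s • η) - V x)) (𝓝[>] 0) (𝓝 d)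

/-- `V` is a pointwise minimum piecewise quadratic control-Lyapunov function of the switched linear
system `x' = A_σ x`. -/
def IsPMPQCLF {n M : ℕ} [NeZero M] (A : Fin M → Matrix (Fin n) (Fin n) ℝ)
    (V : EuclideanSpace ℝ (Fin n) → ℝ) : Prop :=
  IsPMPQF V ∧ (∀ x, 0 ≤ V x) ∧
  ∃ W : EuclideanSpace ℝ (Fin n) → ℝ, Continuous W ∧ (∀ x, 0 ≤ W x) ∧
    (∀ x, x ≠ 0 → 0 < V x ∧ 0 < W x) ∧ V 0 = 0 ∧
    (∀ β : ℝ, Bornology.IsBounded {x | V x ≤ β}) ∧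
    ∀ x, ∃ d : Fin M → ℝ,
      (∀ i, HasDirDeriv V x (Matrix.toEuclideanLin (A i) x) (d i)) ∧
      Finset.univ.inf' Finset.univ_nonempty d ≤ -W x

/-- The solution of the sampled discrete-time system `x(k+1) = exp(h A_{σ(k)}) x(k)`, `x(0) = z`. -/
def sampledState {n M : ℕ} (A : Fin M → Matrix (Fin n) (Fin n) ℝ) (h : ℝ) (σ : ℕ → Fin M)
    (z : EuclideanSpace ℝ (Fin n)) : ℕ → EuclideanSpace ℝ (Fin n)
  | 0 => z
  | k + 1 => Matrix.toEuclideanLin (NormedSpace.exp (h • A (σ k))) (sampledState A h σ z k)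

/-- The `N`-horizon cost `∑_{k=0}^N ‖x(k)‖²` of the sampled system. -/
def horizonCost {n M : ℕ} (A : Fin M → Matrix (Fin n) (Fin n) ℝ) (h : ℝ) (N : ℕ)
    (σ : ℕ → Fin M) (z : EuclideanSpace ℝ (Fin n)) : ℝ :=
  ∑ k ∈ Finset.range (N + 1), ‖sampledState A h σ z k‖ ^ 2

/-- The `N`-horizon value function of the sampled system. The cost depends on finitely many entries
of the switching sequence only, so the infimum is a minimum. -/
def valueFunction {n M : ℕ} (A : Fin M → Matrix (Fin n) (Fin n) ℝ) (h : ℝ) (N : ℕ)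
    (z : EuclideanSpace ℝ (Fin n)) : ℝ :=
  ⨅ σ : ℕ → Fin M, horizonCost A h N σ z

end SwitchedLinear

end

noncomputable section

namespace SwitchedLinear

section

/-! ### Bounds for the exponential in a Banach algebra -/

/-! Stabilizability is used only to obtain a contraction that is uniform in small `h`. A stabilizing
trajectory is followed by sampled ones, because a measurable signal is nearly constant on short
intervals in the L¹ sense (`exists_integrable_mismatch_bound`,
`IsTrajectory.exists_sampled_approx`). Compactness of a sphere and homogeneity then let every state
be halved within one common time `τ` (`SwitchingStabilizable.exists_uniform_contraction`).

Repeating the contraction gives `h * V ≤ K‖z‖²` for the value function, with `K` independent of `h`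
and `N` (`valueFunction_mul_le`). Hence optimal sampled trajectories have a small last state once `N
* h` is large (`norm_terminal_le`).

For the decrease, take an optimal sequence at `x`, let `F` be the flow of its first mode `i` and `Ψ
k` the transitions of the shifted sequence. Up to an error of order `h`, `h * DV(x; A i x)` is at
most `∑ (‖Ψ k (F x)‖² - ‖Ψ k x‖²)`. The shifted sequence is also admissible from `x`, so optimality
bounds this sum by the terminal term minus `‖x‖²` (`optimal_dirDeriv_le`). The error accumulates
over time at most `T`, which is why the bound on `h` depends on `T`.

The piecewise quadratic structure and the directional derivatives come from writing the value
function as a finite minimum of quadratic forms (`isPMPQF_inf'`, `HasDirDeriv.inf'`). -/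

theorem norm_exp_sub_partialSum_le {R : Type*} [NormedRing R] [NormedAlgebra ℝ R] [CompleteSpace R]
    (h1 : ‖(1 : R)‖ ≤ 1) (x : R) (m : ℕ) :
    ‖NormedSpace.exp x - ∑ k ∈ Finset.range m, ((k.factorial : ℝ)⁻¹) • x ^ k‖
      ≤ ‖x‖ ^ m * Real.exp ‖x‖ := by
  have hs : HasSum (fun k : ℕ => ((k.factorial : ℝ)⁻¹) • x ^ k) (NormedSpace.exp x) :=
    NormedSpace.exp_series_hasSum_exp' (𝕂 := ℝ) x
  have hs' := (hasSum_nat_add_iff' m).2 hs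
  have hr : HasSum (fun k : ℕ => ‖x‖ ^ k / (k.factorial : ℝ)) (Real.exp ‖x‖) := by
    have := NormedSpace.exp_series_hasSum_exp' (𝕂 := ℝ) ‖x‖
    rw [← Real.exp_eq_exp_ℝ] at this
    simpa [div_eq_inv_mul] using this
  have hpow : ∀ k : ℕ, ‖x ^ k‖ ≤ ‖x‖ ^ k := by
    intro k
    rcases Nat.eq_zero_or_pos k with rfl | hk
    · simpa using h1
    · exact norm_pow_le' x hk
  have hb : ∀ k : ℕ, ‖(((k + m).factorial : ℝ)⁻¹) • x ^ (k + m)‖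
      ≤ ‖x‖ ^ m * (‖x‖ ^ k / (k.factorial : ℝ)) := by
    intro k
    rw [norm_smul, norm_inv, Real.norm_natCast]
    have hf : (k.factorial : ℝ) ≤ ((k + m).factorial : ℝ) := by
      exact_mod_cast Nat.factorial_le (Nat.le_add_right k m)
    have hk : (0 : ℝ) < k.factorial := by exact_mod_cast Nat.factorial_pos k
    calc ((k + m).factorial : ℝ)⁻¹ * ‖x ^ (k + m)‖
        ≤ (k.factorial : ℝ)⁻¹ * ‖x‖ ^ (k + m) := by
          gcongr
          exact hpow _
      _ = _ := by rw [pow_add]; ring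
  rw [← hs'.tsum_eq, ← (hr.mul_left (‖x‖ ^ m)).tsum_eq]
  have hsum := (hr.mul_left (‖x‖ ^ m)).summable
  have hsn := Summable.of_nonneg_of_le (fun k => norm_nonneg _) hb hsum
  exact (norm_tsum_le_tsum_norm hsn).trans (hsn.tsum_le_tsum hb hsum)

section ExpBounds

variable {E : Type*} [NormedAddCommGroup E] [NormedSpace ℝ E] [CompleteSpace E]

theorem norm_exp_clm_le (B : E →L[ℝ] E) : ‖NormedSpace.exp B‖ ≤ Real.exp ‖B‖ := by
  simpa using norm_exp_sub_partialSum_le (ContinuousLinearMap.norm_id_le (𝕜 := ℝ) (E := E)) B 0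

theorem norm_exp_clm_sub_one_le (B : E →L[ℝ] E) :
    ‖NormedSpace.exp B - 1‖ ≤ ‖B‖ * Real.exp ‖B‖ := by
  simpa using norm_exp_sub_partialSum_le (ContinuousLinearMap.norm_id_le (𝕜 := ℝ) (E := E)) B 1

theorem norm_exp_clm_sub_one_sub_le (B : E →L[ℝ] E) :
    ‖NormedSpace.exp B - 1 - B‖ ≤ ‖B‖ ^ 2 * Real.exp ‖B‖ := by
  simpa [Finset.sum_range_succ, sub_sub] using
    norm_exp_sub_partialSum_le (ContinuousLinearMap.norm_id_le (𝕜 := ℝ) (E := E)) B 2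

end ExpBounds

/-! ### Transition operators of the sampled system -/

variable {n M : ℕ}

/-- The generator of mode `i` as a continuous linear map. -/
def generator (A : Fin M → Matrix (Fin n) (Fin n) ℝ) (i : Fin M) :
    EuclideanSpace ℝ (Fin n) →L[ℝ] EuclideanSpace ℝ (Fin n) :=
  Matrix.toEuclideanCLM (n := Fin n) (𝕜 := ℝ) (A i)

/-- The flow of mode `i` for time `h`. -/
def modeFlow (A : Fin M → Matrix (Fin n) (Fin n) ℝ) (h : ℝ) (i : Fin M) :
    EuclideanSpace ℝ (Fin n) →L[ℝ] EuclideanSpace ℝ (Fin n) :=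
  NormedSpace.exp (h • generator A i)

/-- A continuous algebra isomorphism commutes with the exponential series; the matrix norm opened
here serves only this argument. -/
theorem modeFlow_apply (A : Fin M → Matrix (Fin n) (Fin n) ℝ) (h : ℝ) (i : Fin M)
    (x : EuclideanSpace ℝ (Fin n)) :
    modeFlow A h i x = Matrix.toEuclideanLin (NormedSpace.exp (h • A i)) x := by
  open scoped Matrix.Norms.L2Operator in
  have hc : Continuous (Matrix.toEuclideanCLM (n := Fin n) (𝕜 := ℝ)) :=
    LinearMap.continuous_of_finiteDimensional
      (Matrix.toEuclideanCLM (n := Fin n) (𝕜 := ℝ)).toAlgEquiv.toLinearMap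
  have := NormedSpace.map_exp_of_mem_ball (𝕂 := ℝ) (Matrix.toEuclideanCLM (n := Fin n) (𝕜 := ℝ))
    hc (h • A i) ((NormedSpace.expSeries_radius_eq_top ℝ
      (Matrix (Fin n) (Fin n) ℝ)).symm ▸ edist_lt_top _ _)
  rw [map_smul] at this
  unfold modeFlow generator
  rw [← this]
  rfl

theorem exists_generator_bound (A : Fin M → Matrix (Fin n) (Fin n) ℝ) :
    ∃ a : ℝ, 0 < a ∧ ∀ i, ‖generator A i‖ ≤ a := by
  refine ⟨1 + ∑ i, ‖generator A i‖, by positivity, fun i => ?_⟩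
  have : ‖generator A i‖ ≤ ∑ i, ‖generator A i‖ :=
    Finset.single_le_sum (f := fun i => ‖generator A i‖) (fun _ _ => norm_nonneg _)
      (Finset.mem_univ i)
  linarith

section Bounds

variable {A : Fin M → Matrix (Fin n) (Fin n) ℝ} {a h : ℝ}

theorem norm_smul_generator_le (ha : ∀ i, ‖generator A i‖ ≤ a) (hh : 0 ≤ h) (i : Fin M) :
    ‖h • generator A i‖ ≤ a * h := by
  rw [norm_smul, Real.norm_of_nonneg hh, mul_comm]
  gcongr
  exact ha i

theorem norm_modeFlow_apply_le (ha : ∀ i, ‖generator A i‖ ≤ a) (hh : 0 ≤ h) (i : Fin M)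
    (x : EuclideanSpace ℝ (Fin n)) : ‖modeFlow A h i x‖ ≤ Real.exp (a * h) * ‖x‖ := by
  refine (modeFlow A h i).le_of_opNorm_le ((norm_exp_clm_le _).trans ?_) x
  exact Real.exp_le_exp.2 (norm_smul_generator_le ha hh i)

theorem norm_modeFlow_apply_sub_le (ha : ∀ i, ‖generator A i‖ ≤ a) (hh : 0 ≤ h) (i : Fin M)
    (x : EuclideanSpace ℝ (Fin n)) :
    ‖modeFlow A h i x - x‖ ≤ a * h * Real.exp (a * h) * ‖x‖ := by
  have h0 := norm_smul_generator_le ha hh i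
  refine (modeFlow A h i - 1).le_of_opNorm_le ((norm_exp_clm_sub_one_le _).trans ?_) x
  gcongr
  exact (norm_nonneg _).trans h0

theorem norm_modeFlow_apply_sub_sub_le (ha : ∀ i, ‖generator A i‖ ≤ a) (hh : 0 ≤ h) (i : Fin M)
    (x : EuclideanSpace ℝ (Fin n)) :
    ‖modeFlow A h i x - x - h • generator A i x‖ ≤ (a * h) ^ 2 * Real.exp (a * h) * ‖x‖ := by
  have h0 := norm_smul_generator_le ha hh i
  refine (modeFlow A h i - 1 - h • generator A i).le_of_opNorm_le
    ((norm_exp_clm_sub_one_sub_le _).trans ?_) x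
  gcongr

end Bounds

/-- The operator mapping the initial state to the `k`-th state of the sampled system. -/
def transition (A : Fin M → Matrix (Fin n) (Fin n) ℝ) (h : ℝ) (σ : ℕ → Fin M) :
    ℕ → EuclideanSpace ℝ (Fin n) →L[ℝ] EuclideanSpace ℝ (Fin n)
  | 0 => 1
  | k + 1 => modeFlow A h (σ k) * transition A h σ k

section Transition

variable (A : Fin M → Matrix (Fin n) (Fin n) ℝ) (h : ℝ)

@[simp] theorem transition_zero_apply (σ : ℕ → Fin M) (z : EuclideanSpace ℝ (Fin n)) :
    transition A h σ 0 z = z := rfl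

theorem transition_succ_apply (σ : ℕ → Fin M) (k : ℕ) (z : EuclideanSpace ℝ (Fin n)) :
    transition A h σ (k + 1) z = modeFlow A h (σ k) (transition A h σ k z) := rfl

theorem sampledState_eq_transition (σ : ℕ → Fin M) (z : EuclideanSpace ℝ (Fin n)) (k : ℕ) :
    sampledState A h σ z k = transition A h σ k z := by
  induction k with
  | zero => rfl
  | succ k ih => rw [transition_succ_apply, ← ih, modeFlow_apply]; rfl

theorem transition_congr {σ τ : ℕ → Fin M} {k : ℕ} (hk : ∀ j < k, σ j = τ j) :
    transition A h σ k = transition A h τ k := by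
  induction k with
  | zero => rfl
  | succ k ih =>
    simp only [transition]
    rw [ih fun j hj => hk j (hj.trans k.lt_succ_self), hk k k.lt_succ_self]

theorem transition_add_apply (σ : ℕ → Fin M) (k j : ℕ) (z : EuclideanSpace ℝ (Fin n)) :
    transition A h σ (k + j) z
      = transition A h (fun l => σ (k + l)) j (transition A h σ k z) := by
  induction j with
  | zero => rfl
  | succ j ih => rw [← add_assoc, transition_succ_apply, transition_succ_apply, ih]

theorem transition_succ_apply' (σ : ℕ → Fin M) (k : ℕ) (z : EuclideanSpace ℝ (Fin n)) :
    transition A h σ (k + 1) z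
      = transition A h (fun l => σ (l + 1)) k (modeFlow A h (σ 0) z) := by
  have := transition_add_apply A h σ 1 k z
  simpa [add_comm, transition_succ_apply] using this

variable {A h}

theorem norm_transition_apply_le {a : ℝ} (ha : ∀ i, ‖generator A i‖ ≤ a) (hh : 0 ≤ h)
    (σ : ℕ → Fin M) (k : ℕ) (z : EuclideanSpace ℝ (Fin n)) :
    ‖transition A h σ k z‖ ≤ Real.exp (a * (k * h)) * ‖z‖ := by
  induction k with
  | zero => simp
  | succ k ih =>
    rw [transition_succ_apply]
    refine (norm_modeFlow_apply_le ha hh _ _).trans ?_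
    calc Real.exp (a * h) * ‖transition A h σ k z‖
        ≤ Real.exp (a * h) * (Real.exp (a * (k * h)) * ‖z‖) := by gcongr
      _ = _ := by rw [← mul_assoc, ← Real.exp_add]; push_cast; ring_nf

end Transition

theorem exists_concat {α : Type*} (σ τ : ℕ → α) (k : ℕ) :
    ∃ ρ : ℕ → α, (∀ j < k, ρ j = σ j) ∧ ∀ j, ρ (k + j) = τ j :=
  ⟨fun j => if j < k then σ j else τ (j - k), fun j hj => by simp [hj], fun j => by simp⟩

/-! ### The value function -/

section Value

variable (A : Fin M → Matrix (Fin n) (Fin n) ℝ) (h : ℝ)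

theorem horizonCost_eq (N : ℕ) (σ : ℕ → Fin M) (z : EuclideanSpace ℝ (Fin n)) :
    horizonCost A h N σ z = ∑ k ∈ Finset.range (N + 1), ‖transition A h σ k z‖ ^ 2 := by
  simp only [horizonCost, sampledState_eq_transition]

theorem horizonCost_nonneg (N : ℕ) (σ : ℕ → Fin M) (z : EuclideanSpace ℝ (Fin n)) :
    0 ≤ horizonCost A h N σ z :=
  Finset.sum_nonneg fun _ _ => by positivity

theorem valueFunction_le (N : ℕ) (σ : ℕ → Fin M) (z : EuclideanSpace ℝ (Fin n)) :
    valueFunction A h N z ≤ horizonCost A h N σ z :=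
  ciInf_le ⟨0, by rintro _ ⟨σ, rfl⟩; exact horizonCost_nonneg A h N σ z⟩ σ

theorem horizonCost_congr {N : ℕ} {σ τ : ℕ → Fin M} (hN : ∀ j < N, σ j = τ j)
    (z : EuclideanSpace ℝ (Fin n)) : horizonCost A h N σ z = horizonCost A h N τ z := by
  rw [horizonCost_eq, horizonCost_eq]
  refine Finset.sum_congr rfl fun k hk => ?_
  rw [transition_congr A h fun j hj => hN j (hj.trans_le (Nat.lt_succ_iff.1 (Finset.mem_range.1 hk)))]

variable [NeZero M]

/-- Extension of a finite switching sequence by the mode `0`. -/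
def extendSignal {N : ℕ} (τ : Fin N → Fin M) (k : ℕ) : Fin M :=
  if hk : k < N then τ ⟨k, hk⟩ else 0

theorem horizonCost_extendSignal (N : ℕ) (σ : ℕ → Fin M) (z : EuclideanSpace ℝ (Fin n)) :
    horizonCost A h N (extendSignal fun k : Fin N => σ k) z = horizonCost A h N σ z :=
  horizonCost_congr A h (fun j hj => by simp [extendSignal, hj]) z

/-- The cost sees only the first `N` modes, so finitely many sequences suffice. Attainment of the
infimum and its piecewise quadratic form both rest on this. -/
theorem valueFunction_eq_inf' (N : ℕ) (z : EuclideanSpace ℝ (Fin n)) :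
    valueFunction A h N z = Finset.univ.inf' Finset.univ_nonempty
      (fun τ : Fin N → Fin M => horizonCost A h N (extendSignal τ) z) := by
  apply le_antisymm
  · exact Finset.le_inf' _ _ fun τ _ => valueFunction_le A h N _ z
  · refine le_ciInf fun σ => ?_
    rw [← horizonCost_extendSignal]
    exact Finset.inf'_le _ (Finset.mem_univ _)

theorem exists_optimal (N : ℕ) (z : EuclideanSpace ℝ (Fin n)) :
    ∃ τ : Fin N → Fin M, horizonCost A h N (extendSignal τ) z = valueFunction A h N z := by
  rw [valueFunction_eq_inf']
  obtain ⟨τ, -, hτ⟩ := Finset.exists_mem_eq_inf' Finset.univ_nonempty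
    (fun τ : Fin N → Fin M => horizonCost A h N (extendSignal τ) z)
  exact ⟨τ, hτ.symm⟩

theorem norm_sq_le_valueFunction (N : ℕ) (z : EuclideanSpace ℝ (Fin n)) :
    ‖z‖ ^ 2 ≤ valueFunction A h N z := by
  refine le_ciInf fun σ => ?_
  rw [horizonCost_eq]
  have := Finset.single_le_sum (f := fun k => ‖transition A h σ k z‖ ^ 2)
    (fun _ _ => sq_nonneg _) (Finset.mem_range.2 N.succ_pos)
  rwa [transition_zero_apply] at this

theorem valueFunction_zero (N : ℕ) : valueFunction A h N 0 = 0 := by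
  simp [valueFunction, horizonCost_eq]

/-- One half of the dynamic programming principle. -/
theorem valueFunction_add_le (k N : ℕ) (σ : ℕ → Fin M) (z : EuclideanSpace ℝ (Fin n)) :
    valueFunction A h (k + N) z ≤ ∑ j ∈ Finset.range k, ‖transition A h σ j z‖ ^ 2
      + valueFunction A h N (transition A h σ k z) := by
  obtain ⟨τ, hτ⟩ := exists_optimal A h N (transition A h σ k z)
  obtain ⟨ρ, h1, h2⟩ := exists_concat σ (extendSignal τ) k
  refine (valueFunction_le A h _ ρ z).trans_eq ?_
  rw [← hτ, horizonCost_eq, horizonCost_eq, add_assoc, Finset.sum_range_add]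
  congr 1
  · refine Finset.sum_congr rfl fun j hj => ?_
    rw [transition_congr A h fun l hl => h1 l (hl.trans (Finset.mem_range.1 hj))]
  · refine Finset.sum_congr rfl fun j _ => ?_
    rw [transition_add_apply, transition_congr A h h1]
    simp only [h2]

/-- Tails of optimal sequences are optimal. -/
theorem tail_le_valueFunction (k N : ℕ) {σ : ℕ → Fin M} {z : EuclideanSpace ℝ (Fin n)}
    (hσ : horizonCost A h (k + N) σ z = valueFunction A h (k + N) z) :
    ∑ j ∈ Finset.range (N + 1), ‖transition A h σ (k + j) z‖ ^ 2
      ≤ valueFunction A h N (transition A h σ k z) := by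
  have := valueFunction_add_le A h k N σ z
  rw [← hσ, horizonCost_eq, add_assoc, Finset.sum_range_add] at this
  linarith

end Value

end

section

/-! ### Mean value inequality for absolutely continuous functions -/

theorem _root_.LipschitzWith.comp_absolutelyContinuousOnInterval {X Y : Type*}
    [PseudoMetricSpace X] [PseudoMetricSpace Y] {K : NNReal} {g : X → Y} (hg : LipschitzWith K g)
    {f : ℝ → X} {b c : ℝ} (hf : AbsolutelyContinuousOnInterval f b c) :
    AbsolutelyContinuousOnInterval (fun t => g (f t)) b c := by
  unfold AbsolutelyContinuousOnInterval at *
  refine squeeze_zero (fun _ => Finset.sum_nonneg fun _ _ => dist_nonneg) (fun p => ?_)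
    (by simpa using hf.const_mul (K : ℝ))
  rw [Finset.mul_sum]
  exact Finset.sum_le_sum fun i _ => hg.dist_le_mul _ _

/-- Pairing `f` with the unit vector in the direction `f c - f b` reduces this to the fundamental
theorem of calculus for real absolutely continuous functions. -/
theorem norm_sub_le_integral_of_absolutelyContinuous {E : Type*} [NormedAddCommGroup E]
    [InnerProductSpace ℝ E] {f f' : ℝ → E} {g : ℝ → ℝ} {b c : ℝ} (hbc : b ≤ c)
    (hf : AbsolutelyContinuousOnInterval f b c)
    (hf' : ∀ᵐ t, t ∈ Set.Ioc b c → HasDerivAt f (f' t) t)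
    (hg : IntervalIntegrable g volume b c)
    (hfg : ∀ t ∈ Set.Ioc b c, ‖f' t‖ ≤ g t) :
    ‖f c - f b‖ ≤ ∫ t in b..c, g t := by
  rcases eq_or_ne (f c - f b) 0 with h0 | h0
  · rw [h0, norm_zero]
    exact intervalIntegral.integral_nonneg_of_ae_restrict hbc <| by
      have : ∀ᵐ t ∂volume.restrict (Set.Ioc b c), 0 ≤ g t :=
        (ae_restrict_iff' measurableSet_Ioc).2 <| Eventually.of_forall fun t ht =>
          (norm_nonneg _).trans (hfg t ht)
      rwa [← restrict_Ioc_eq_restrict_Icc]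
  set v : E := (‖f c - f b‖⁻¹ : ℝ) • (f c - f b) with hv
  have hnv : ‖v‖ = 1 := by
    rw [hv, norm_smul, norm_inv, norm_norm, inv_mul_cancel₀ (norm_ne_zero_iff.2 h0)]
  have hac : AbsolutelyContinuousOnInterval (fun t => inner ℝ v (f t)) b c :=
    (innerSL ℝ v).lipschitz.comp_absolutelyContinuousOnInterval hf
  have hval : inner ℝ v (f c) - inner ℝ v (f b) = ‖f c - f b‖ := by
    rw [← inner_sub_right, hv, real_inner_smul_left, real_inner_self_eq_norm_sq]
    field_simp [norm_ne_zero_iff.2 h0]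
  have hint := hac.integral_deriv_eq_sub
  simp only [hval] at hint
  rw [← hint]
  refine intervalIntegral.integral_mono_ae_restrict hbc hac.intervalIntegrable_deriv hg ?_
  rw [← restrict_Ioc_eq_restrict_Icc]
  refine (ae_restrict_iff' measurableSet_Ioc).2 ?_
  filter_upwards [hf'] with t ht htm
  have hd : HasDerivAt (fun s => inner ℝ v (f s)) (inner ℝ v (f' t)) t :=
    (innerSL ℝ v).hasFDerivAt.comp_hasDerivAt t (ht htm)
  rw [hd.deriv]
  calc inner ℝ v (f' t) ≤ ‖v‖ * ‖f' t‖ := real_inner_le_norm _ _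
    _ ≤ g t := by rw [hnv, one_mul]; exact hfg t htm

end

section

variable {n M : ℕ}

/-! ### Approximation of trajectories by sampled trajectories -/

section Approximation

variable {A : Fin M → Matrix (Fin n) (Fin n) ℝ} {a : ℝ} {σ : ℝ → Fin M}
  {z : EuclideanSpace ℝ (Fin n)} {x : ℝ → EuclideanSpace ℝ (Fin n)}

theorem IsTrajectory.absolutelyContinuousOnInterval (hx : IsTrajectory A σ z x) {b c : ℝ}
    (hb : 0 ≤ b) (hbc : b ≤ c) : AbsolutelyContinuousOnInterval x b c :=
  (hx.2.1 c (hb.trans hbc)).mono <| by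
    rw [Set.uIcc_of_le hbc, Set.uIcc_of_le (hb.trans hbc)]
    exact Set.Icc_subset_Icc_left hb

theorem IsTrajectory.ae_hasDerivAt (hx : IsTrajectory A σ z x) {b c : ℝ} (hb : 0 ≤ b) :
    ∀ᵐ t, t ∈ Set.Ioc b c → HasDerivAt x (generator A (σ t) (x t)) t := by
  have := (ae_restrict_iff' measurableSet_Ici).1 hx.2.2
  filter_upwards [this] with t ht htm
  exact ht (hb.trans htm.1.le)

theorem norm_generator_apply_le (ha : ∀ i, ‖generator A i‖ ≤ a) (i : Fin M)
    (y : EuclideanSpace ℝ (Fin n)) : ‖generator A i y‖ ≤ a * ‖y‖ :=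
  (generator A i).le_of_opNorm_le (ha i) y

theorem IsTrajectory.norm_sub_le (hx : IsTrajectory A σ z x) (ha0 : 0 ≤ a)
    (ha : ∀ i, ‖generator A i‖ ≤ a)
    (hx1 : ∀ t, 0 ≤ t → ‖x t‖ ≤ 1) {b c : ℝ} (hb : 0 ≤ b) (hbc : b ≤ c) :
    ‖x c - x b‖ ≤ a * (c - b) := by
  have := norm_sub_le_integral_of_absolutelyContinuous hbc
    (hx.absolutelyContinuousOnInterval hb hbc) (hx.ae_hasDerivAt hb) (g := fun _ => a)
    intervalIntegrable_const fun t ht => by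
      refine (norm_generator_apply_le ha _ _).trans ?_
      have := hx1 t (hb.trans ht.1.le)
      nlinarith
  simpa [mul_comm] using this

/-- Two errors add up: a wrong mode costs at most `2 * a` per unit time, paid by `G`, and freezing
the state at time `b` costs at most `a * (a * h)`. -/
theorem IsTrajectory.norm_sub_sub_le (hx : IsTrajectory A σ z x) (ha0 : 0 ≤ a)
    (ha : ∀ i, ‖generator A i‖ ≤ a)
    (hx1 : ∀ t, 0 ≤ t → ‖x t‖ ≤ 1) {b h : ℝ} (hb : 0 ≤ b) (hh : 0 ≤ h) {G : ℝ → ℝ}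
    (hG0 : ∀ t, 0 ≤ G t) (i : Fin M) (hG : ∀ t ∈ Set.Ioc b (b + h), σ t ≠ i → 1 ≤ G t)
    (hGi : IntervalIntegrable G volume b (b + h)) :
    ‖x (b + h) - x b - h • generator A i (x b)‖
      ≤ 2 * a * (∫ t in b..(b + h), G t) + a ^ 2 * h ^ 2 := by
  have hbh : b ≤ b + h := by linarith
  set w := generator A i (x b) with hw
  have hlin : AbsolutelyContinuousOnInterval (fun t : ℝ => t • w) b (b + h) :=
    ((ContinuousLinearMap.toSpanSingleton ℝ w).lipschitz.lipschitzOnWith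
      (s := Set.uIcc b (b + h))).absolutelyContinuousOnInterval
  have hint : IntervalIntegrable (fun t => 2 * a * G t + a ^ 2 * h) volume b (b + h) :=
    (hGi.const_mul _).add intervalIntegrable_const
  have key := norm_sub_le_integral_of_absolutelyContinuous hbh
    ((hx.absolutelyContinuousOnInterval hb hbh).fun_sub hlin)
    (f' := fun t => generator A (σ t) (x t) - w) (g := fun t => 2 * a * G t + a ^ 2 * h)
    (by
      filter_upwards [hx.ae_hasDerivAt (c := b + h) hb] with t ht htm
      have := (ht htm).fun_sub ((hasDerivAt_id' t).smul_const w)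
      rw [one_smul] at this
      exact this) hint
    (fun t ht => by
      have ht0 : 0 ≤ t := hb.trans ht.1.le
      have hsplit : generator A (σ t) (x t) - w
          = (generator A (σ t) (x t) - generator A i (x t)) + generator A i (x t - x b) := by
        rw [map_sub, hw]; abel
      have h1 : ‖generator A (σ t) (x t) - generator A i (x t)‖ ≤ 2 * a * G t := by
        by_cases hs : σ t = i
        · rw [hs, sub_self, norm_zero]
          have := hG0 t
          positivity
        · have h2 := hG t ht hs
          have h3 := norm_generator_apply_le ha (σ t) (x t)
          have h4 := norm_generator_apply_le ha i (x t)
          have h5 := hx1 t ht0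
          have h6 := _root_.norm_sub_le (generator A (σ t) (x t)) (generator A i (x t))
          nlinarith
      have h7 : ‖generator A i (x t - x b)‖ ≤ a ^ 2 * h := by
        refine (norm_generator_apply_le ha _ _).trans ?_
        have h8 := hx.norm_sub_le ha0 ha hx1 hb ht.1.le
        have h9 : t - b ≤ h := by linarith [ht.2]
        calc a * ‖x t - x b‖ ≤ a * (a * h) := by
              gcongr
              exact h8.trans (by gcongr)
          _ = _ := by ring
      rw [hsplit]
      exact (norm_add_le _ _).trans (add_le_add h1 h7))
  have e1 : x (b + h) - (b + h) • w - (x b - b • w) = x (b + h) - x b - h • w := by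
    rw [add_smul]; abel
  rw [e1, intervalIntegral.integral_add (hGi.const_mul _) intervalIntegrable_const,
    intervalIntegral.integral_const_mul, intervalIntegral.integral_const] at key
  refine key.trans_eq ?_
  simp only [add_sub_cancel_left, smul_eq_mul]
  ring

theorem IsTrajectory.norm_sub_modeFlow_le (hx : IsTrajectory A σ z x) (ha0 : 0 ≤ a)
    (ha : ∀ i, ‖generator A i‖ ≤ a)
    (hx1 : ∀ t, 0 ≤ t → ‖x t‖ ≤ 1) {b h : ℝ} (hb : 0 ≤ b) (hh : 0 ≤ h) {G : ℝ → ℝ}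
    (hG0 : ∀ t, 0 ≤ G t) (i : Fin M) (hG : ∀ t ∈ Set.Ioc b (b + h), σ t ≠ i → 1 ≤ G t)
    (hGi : IntervalIntegrable G volume b (b + h)) (y : EuclideanSpace ℝ (Fin n)) :
    ‖x (b + h) - modeFlow A h i y‖ ≤ Real.exp (a * h) * ‖x b - y‖
      + (2 * a * (∫ t in b..(b + h), G t) + a ^ 2 * h ^ 2 * (1 + Real.exp (a * h))) := by
  have h1 := hx.norm_sub_sub_le ha0 ha hx1 hb hh hG0 i hG hGi
  have h2 := norm_modeFlow_apply_sub_sub_le ha hh i (x b)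
  have h3 := norm_modeFlow_apply_le ha hh i (x b - y)
  have h4 : (a * h) ^ 2 * Real.exp (a * h) * ‖x b‖ ≤ (a * h) ^ 2 * Real.exp (a * h) :=
    mul_le_of_le_one_right (by positivity) (hx1 b hb)
  have e : x (b + h) - modeFlow A h i y = modeFlow A h i (x b - y)
      + ((x (b + h) - x b - h • generator A i (x b))
        - (modeFlow A h i (x b) - x b - h • generator A i (x b))) := by
    rw [map_sub]; abel
  rw [e]
  have h5 := norm_add_le (modeFlow A h i (x b - y)) ((x (b + h) - x b - h • generator A i (x b))
        - (modeFlow A h i (x b) - x b - h • generator A i (x b)))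
  have h6 := _root_.norm_sub_le (x (b + h) - x b - h • generator A i (x b))
        (modeFlow A h i (x b) - x b - h • generator A i (x b))
  nlinarith

/-- Discrete Gronwall estimate: one-step errors add, each amplified by no more than the total growth
factor. -/
theorem IsTrajectory.norm_sub_transition_le (hx : IsTrajectory A σ z x) (ha0 : 0 ≤ a)
    (ha : ∀ i, ‖generator A i‖ ≤ a)
    (hx1 : ∀ t, 0 ≤ t → ‖x t‖ ≤ 1) {h : ℝ} (hh : 0 ≤ h) {G : ℝ → ℝ}
    (hG0 : ∀ t, 0 ≤ G t) (hGi : Integrable G) (ρ : ℕ → Fin M) (k : ℕ)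
    (hG : ∀ j < k, ∀ t ∈ Set.Ioc (j * h : ℝ) (j * h + h), σ t ≠ ρ j → 1 ≤ G t) :
    ‖x (k * h) - transition A h ρ k z‖ ≤ Real.exp (a * (k * h)) *
      (2 * a * (∫ t in (0 : ℝ)..(k * h), G t)
        + k * (a ^ 2 * h ^ 2 * (1 + Real.exp (a * h)))) := by
  induction k with
  | zero => simp [hx.1]
  | succ k ih =>
    have ih := ih fun j hj => hG j (hj.trans k.lt_succ_self)
    have hk0 : (0 : ℝ) ≤ k * h := by positivity
    have h1 := hx.norm_sub_modeFlow_le ha0 ha hx1 hk0 hh hG0 (ρ k) (hG k k.lt_succ_self)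
      hGi.intervalIntegrable (transition A h ρ k z)
    have e1 : ((k + 1 : ℕ) : ℝ) * h = k * h + h := by push_cast; ring
    have e2 : Real.exp (a * (k * h + h)) = Real.exp (a * h) * Real.exp (a * (k * h)) := by
      rw [← Real.exp_add]; ring_nf
    rw [e1, transition_succ_apply, ← intervalIntegral.integral_add_adjacent_intervals
      (hGi.intervalIntegrable (a := 0) (b := k * h)) hGi.intervalIntegrable, e2]
    refine h1.trans ?_
    have hI : 0 ≤ ∫ t in (k * h : ℝ)..(k * h + h), G t :=
      intervalIntegral.integral_nonneg_of_forall (by linarith) hG0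
    have hE : 1 ≤ Real.exp (a * h) * Real.exp (a * (k * h)) := by
      rw [← e2]; exact Real.one_le_exp (by positivity)
    have h2 : Real.exp (a * h) * ‖x (k * h) - transition A h ρ k z‖ ≤ Real.exp (a * h) *
        (Real.exp (a * (k * h)) * (2 * a * (∫ t in (0 : ℝ)..(k * h), G t)
        + k * (a ^ 2 * h ^ 2 * (1 + Real.exp (a * h))))) := by gcongr
    have hR : 0 ≤ 2 * a * (∫ t in (k * h : ℝ)..(k * h + h), G t)
        + a ^ 2 * h ^ 2 * (1 + Real.exp (a * h)) := by positivity
    have h3 := le_mul_of_one_le_left hR hE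
    push_cast
    linarith

/-- The signal, read as an integer-valued function `s`, is L¹-close to a uniformly continuous `g`.
On a short interval `i` is the mode nearest to `g b`. Distinct modes are at distance at least 1, so
a mismatch forces `|σ t - g b| ≥ 1/2`, hence `|s t - g t| ≥ 1/4`. -/
theorem exists_integrable_mismatch_bound (hσ : Measurable σ) {τ ε : ℝ} (hε : 0 < ε) [NeZero M] :
    ∃ G : ℝ → ℝ, (∀ t, 0 ≤ G t) ∧ Integrable G ∧ ∫ t, G t ≤ ε ∧ ∃ δ : ℝ, 0 < δ ∧
      ∀ b h : ℝ, 0 ≤ b → h < δ → b + h ≤ τ → ∃ i : Fin M,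
        ∀ t ∈ Set.Ioc b (b + h), σ t ≠ i → 1 ≤ G t := by
  set s : ℝ → ℝ := (Set.Ioc 0 τ).indicator fun t => ((σ t : ℕ) : ℝ) with hs
  have hmeas : Measurable fun t => ((σ t : ℕ) : ℝ) :=
    (measurable_of_finite fun i : Fin M => ((i : ℕ) : ℝ)).comp hσ
  have hsi : Integrable s := by
    rw [hs, integrable_indicator_iff measurableSet_Ioc]
    refine Measure.integrableOn_of_bounded (M := M) (by simp) hmeas.aestronglyMeasurable ?_
    refine Eventually.of_forall fun t => ?_
    rw [Real.norm_natCast]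
    exact_mod_cast (σ t).2.le
  obtain ⟨g, hgc, hg1, hg2, hg3⟩ :=
    hsi.exists_hasCompactSupport_integral_sub_le (show 0 < ε / 4 by positivity)
  obtain ⟨δ, hδ, hu⟩ := Metric.uniformContinuous_iff.1
    (hgc.uniformContinuous_of_continuous hg2) (1 / 4) (by norm_num)
  refine ⟨fun t => 4 * ‖s t - g t‖, fun t => by positivity, (hsi.sub hg3).norm.const_mul 4, ?_,
    δ, hδ, fun b h hb hh hbh => ?_⟩
  · rw [integral_const_mul]; linarith
  · obtain ⟨i, hi⟩ := Finite.exists_min fun i : Fin M => |((i : ℕ) : ℝ) - g b|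
    refine ⟨i, fun t ht hne => ?_⟩
    have hst : s t = ((σ t : ℕ) : ℝ) :=
      Set.indicator_of_mem (show t ∈ Set.Ioc 0 τ from ⟨hb.trans_lt ht.1, ht.2.trans hbh⟩) _
    have h1 : (1 : ℝ) ≤ |((σ t : ℕ) : ℝ) - ((i : ℕ) : ℝ)| := by
      have : ((σ t : ℕ) : ℤ) - ((i : ℕ) : ℤ) ≠ 0 := by
        intro h0
        exact hne (Fin.ext (by omega))
      exact_mod_cast Int.one_le_abs this
    have h2 := hi (σ t)
    have h3 : |g t - g b| < 1 / 4 := by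
      rw [← Real.dist_eq]
      refine hu ?_
      rw [Real.dist_eq, abs_of_pos (by linarith [ht.1])]
      linarith [ht.2]
    change 1 ≤ 4 * ‖s t - g t‖
    rw [Real.norm_eq_abs, hst]
    have h4 := abs_sub_le ((σ t : ℕ) : ℝ) (g b) ((i : ℕ) : ℝ)
    have h5 := abs_sub_le ((σ t : ℕ) : ℝ) (g t) (g b)
    rw [abs_sub_comm (g b)] at h4
    linarith

theorem IsTrajectory.exists_sampled_approx [NeZero M] (hx : IsTrajectory A σ z x)
    (hσ : Measurable σ) (hx1 : ∀ t, 0 ≤ t → ‖x t‖ ≤ 1) {τ ε : ℝ} (hτ : 0 ≤ τ) (hε : 0 < ε) :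
    ∃ h₁ : ℝ, 0 < h₁ ∧ ∀ h, 0 < h → h < h₁ → ∃ ρ : ℕ → Fin M, ∀ k : ℕ, k * h ≤ τ →
      ‖x (k * h) - transition A h ρ k z‖ ≤ ε := by
  obtain ⟨a, ha0, ha⟩ := exists_generator_bound A
  set Γ := Real.exp (a * τ) with hΓ
  have hΓ0 : 0 < Γ := Real.exp_pos _
  set D := Γ * (τ * a ^ 2 * (1 + Real.exp a)) with hD
  have hD0 : 0 ≤ D := by positivity
  -- The mismatch uses up `ε / 2`; the discretization error `D * h` gets the other half.
  obtain ⟨G, hG0, hGi, hGε, δ, hδ, hG⟩ := exists_integrable_mismatch_bound hσ (τ := τ)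
    (show 0 < ε / (4 * a * Γ) by positivity)
  refine ⟨min δ (min 1 (ε / (2 * (D + 1)))), by positivity, fun h hh hh1 => ?_⟩
  have hhδ : h < δ := hh1.trans_le (min_le_left _ _)
  have hh1' : h ≤ 1 := hh1.le.trans ((min_le_right _ _).trans (min_le_left _ _))
  have hhD : h ≤ ε / (2 * (D + 1)) := hh1.le.trans ((min_le_right _ _).trans (min_le_right _ _))
  choose! m hm using fun b (hb : 0 ≤ b ∧ b + h ≤ τ) => hG b h hb.1 hhδ hb.2
  refine ⟨fun j => m (j * h), fun k hk => ?_⟩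
  have h1 := hx.norm_sub_transition_le ha0.le ha hx1 hh.le hG0 hGi (fun j => m (j * h)) k
    (fun j hj => hm (j * h) ⟨by positivity, by
      have : ((j : ℝ) + 1) ≤ k := by exact_mod_cast hj
      nlinarith⟩)
  refine h1.trans ?_
  have hI : ∫ t in (0 : ℝ)..(k * h), G t ≤ ε / (4 * a * Γ) := by
    rw [intervalIntegral.integral_of_le (by positivity)]
    exact (setIntegral_le_integral hGi (Eventually.of_forall hG0)).trans hGε
  have hI0 : 0 ≤ ∫ t in (0 : ℝ)..(k * h), G t :=
    intervalIntegral.integral_nonneg_of_forall (by positivity) hG0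
  have hexp : Real.exp (a * (k * h)) ≤ Γ := Real.exp_le_exp.2 (by gcongr)
  have hexp2 : Real.exp (a * h) ≤ Real.exp a := Real.exp_le_exp.2 (by nlinarith)
  calc Real.exp (a * (k * h)) * (2 * a * (∫ t in (0 : ℝ)..(k * h), G t)
        + k * (a ^ 2 * h ^ 2 * (1 + Real.exp (a * h))))
      ≤ Γ * (2 * a * (ε / (4 * a * Γ)) + τ * (a ^ 2 * h * (1 + Real.exp a))) := by
        have : k * (a ^ 2 * h ^ 2 * (1 + Real.exp (a * h)))
            = (k * h) * (a ^ 2 * h * (1 + Real.exp (a * h))) := by ring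
        rw [this]
        gcongr
    _ = ε / 2 + D * h := by rw [hD]; field_simp; ring
    _ ≤ ε := by
        have h2 : h * (2 * (D + 1)) ≤ ε := (le_div_iff₀ (by positivity)).1 hhD
        nlinarith

end Approximation

/-! ### Uniform contraction of the sampled system -/

section Contraction

variable [NeZero M] {A : Fin M → Matrix (Fin n) (Fin n) ℝ}

theorem SwitchingStabilizable.exists_pointwise_contraction (hA : SwitchingStabilizable A) :
    ∃ r : ℝ, 0 < r ∧ ∀ z : EuclideanSpace ℝ (Fin n), ‖z‖ = r → ∃ τ h₁ : ℝ, 0 < τ ∧ 0 < h₁ ∧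
      ∀ h, 0 < h → h < h₁ → ∃ p : ℕ, 1 ≤ p ∧ p * h ≤ τ ∧ ∃ ρ : ℕ → Fin M,
        ‖transition A h ρ p z‖ ≤ r / 4 := by
  -- Taking `ε = 1` supplies the unit bound on the trajectory that the approximation needs.
  obtain ⟨δ, hδ, H⟩ := hA 1 one_pos
  refine ⟨δ / 2, by positivity, fun z hz => ?_⟩
  obtain ⟨σ, hσ, x, hx, hx1, hx0⟩ := H z (by linarith)
  obtain ⟨t₀, ht₀⟩ := (Metric.tendsto_atTop.1 hx0) (δ / 16) (by positivity)
  set τ := max t₀ 1 with hτ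
  have hτ1 : 1 ≤ τ := le_max_right _ _
  obtain ⟨h₁, hh₁, H'⟩ := hx.exists_sampled_approx hσ (fun t ht => (hx1 t ht).le)
    (τ := τ + 1) (by positivity) (show 0 < δ / 16 by positivity)
  refine ⟨τ + 1, min h₁ 1, by positivity, by positivity, fun h hh hh1 => ?_⟩
  obtain ⟨ρ, hρ⟩ := H' h hh (hh1.trans_le (min_le_left _ _))
  have hp1 : τ ≤ ⌈τ / h⌉₊ * h := (div_le_iff₀ hh).1 (Nat.le_ceil _)
  have hp2 : ⌈τ / h⌉₊ * h ≤ τ + 1 := by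
    have h1 := (Nat.ceil_lt_add_one (show 0 ≤ τ / h by positivity)).le
    have h2 : h ≤ 1 := hh1.le.trans (min_le_right _ _)
    calc ⌈τ / h⌉₊ * h ≤ (τ / h + 1) * h := by gcongr
      _ = τ + h := by field_simp
      _ ≤ τ + 1 := by linarith
  refine ⟨⌈τ / h⌉₊, Nat.one_le_ceil_iff.2 (by positivity), hp2, ρ, ?_⟩
  have h3 := hρ _ hp2
  have h4 := ht₀ (⌈τ / h⌉₊ * h) ((le_max_left _ _).trans hp1)
  rw [dist_zero_right] at h4
  have h5 := norm_sub_norm_le (transition A h ρ ⌈τ / h⌉₊ z) (x (⌈τ / h⌉₊ * h))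
  rw [norm_sub_rev] at h5
  linarith

/-- The pointwise contraction extends to neighbourhoods with the same signal; compact induction
makes `τ` and `h₁` common to the sphere, and linearity rescales. -/
theorem SwitchingStabilizable.exists_uniform_contraction (hA : SwitchingStabilizable A) :
    ∃ τ h₁ : ℝ, 0 < τ ∧ 0 < h₁ ∧ ∀ h, 0 < h → h < h₁ → ∀ z : EuclideanSpace ℝ (Fin n),
      ∃ p : ℕ, 1 ≤ p ∧ p * h ≤ τ ∧ ∃ ρ : ℕ → Fin M,
        ‖transition A h ρ p z‖ ≤ 1 / 2 * ‖z‖ := by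
  obtain ⟨a, ha0, ha⟩ := exists_generator_bound A
  obtain ⟨r, hr, H⟩ := hA.exists_pointwise_contraction
  have key : ∃ τ h₁ : ℝ, 0 < τ ∧ 0 < h₁ ∧ ∀ h, 0 < h → h < h₁ →
      ∀ z ∈ Metric.sphere (0 : EuclideanSpace ℝ (Fin n)) r,
      ∃ p : ℕ, 1 ≤ p ∧ p * h ≤ τ ∧ ∃ ρ : ℕ → Fin M, ‖transition A h ρ p z‖ ≤ r / 2 := by
    refine (isCompact_sphere (0 : EuclideanSpace ℝ (Fin n)) r).induction_on
      (p := fun s => ∃ τ h₁ : ℝ, 0 < τ ∧ 0 < h₁ ∧ ∀ h, 0 < h → h < h₁ → ∀ z ∈ s,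
      ∃ p : ℕ, 1 ≤ p ∧ p * h ≤ τ ∧ ∃ ρ : ℕ → Fin M, ‖transition A h ρ p z‖ ≤ r / 2) ?_ ?_ ?_ ?_
    · exact ⟨1, 1, one_pos, one_pos, by simp⟩
    · rintro s t hst ⟨τ, h₁, hτ, hh₁, h⟩
      exact ⟨τ, h₁, hτ, hh₁, fun h' h0 h1 z hz => h h' h0 h1 z (hst hz)⟩
    · rintro s t ⟨τ, h₁, hτ, hh₁, hs⟩ ⟨τ', h₁', hτ', hh₁', ht⟩
      refine ⟨max τ τ', min h₁ h₁', by positivity, by positivity, fun h h0 h1 z hz => ?_⟩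
      rcases hz with hz | hz
      · obtain ⟨p, hp, hp', hρ⟩ := hs h h0 (h1.trans_le (min_le_left _ _)) z hz
        exact ⟨p, hp, hp'.trans (le_max_left _ _), hρ⟩
      · obtain ⟨p, hp, hp', hρ⟩ := ht h h0 (h1.trans_le (min_le_right _ _)) z hz
        exact ⟨p, hp, hp'.trans (le_max_right _ _), hρ⟩
    · intro z hz
      obtain ⟨τ, h₁, hτ, hh₁, Hz⟩ := H z (by simpa using hz)
      -- Distances grow by at most `exp (a * τ)` up to time `τ`, so points of this ball end within
      -- `r / 4` of the endpoint from `z`.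
      refine ⟨Metric.ball z (r / 4 * Real.exp (-(a * τ))),
        mem_nhdsWithin_of_mem_nhds (Metric.ball_mem_nhds _ (by positivity)), τ, h₁, hτ, hh₁,
        fun h h0 h1 y hy => ?_⟩
      obtain ⟨p, hp, hp', ρ, hρ⟩ := Hz h h0 h1
      refine ⟨p, hp, hp', ρ, ?_⟩
      have h2 : ‖transition A h ρ p (y - z)‖ ≤ r / 4 := by
        refine (norm_transition_apply_le ha h0.le ρ p _).trans ?_
        have h3 : ‖y - z‖ ≤ r / 4 * Real.exp (-(a * τ)) := by
          rw [← dist_eq_norm]; exact (Metric.mem_ball.1 hy).le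
        calc Real.exp (a * (p * h)) * ‖y - z‖
            ≤ Real.exp (a * τ) * (r / 4 * Real.exp (-(a * τ))) := by gcongr
          _ = r / 4 := by rw [Real.exp_neg]; field_simp
      rw [map_sub] at h2
      have h4 := norm_sub_norm_le (transition A h ρ p y) (transition A h ρ p z)
      linarith
  obtain ⟨τ, h₁, hτ, hh₁, K⟩ := key
  refine ⟨max τ 1, min h₁ 1, by positivity, by positivity, fun h h0 h1 z => ?_⟩
  have hh : h < h₁ := h1.trans_le (min_le_left _ _)
  rcases eq_or_ne z 0 with rfl | hz
  -- One step must fit into the time bound; hence `max τ 1` and `min h₁ 1`.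
  · exact ⟨1, le_rfl, by simpa using Or.inr (h1.le.trans (min_le_right _ _)), fun _ => 0, by simp⟩
  have hz' : 0 < ‖z‖ := norm_pos_iff.2 hz
  obtain ⟨p, hp, hp', ρ, hρ⟩ := K h h0 hh ((r / ‖z‖) • z) (by
    rw [mem_sphere_zero_iff_norm, norm_smul, Real.norm_of_nonneg (by positivity)]
    field_simp)
  refine ⟨p, hp, hp'.trans (le_max_left _ _), ρ, ?_⟩
  rw [map_smul, norm_smul, Real.norm_of_nonneg (by positivity), div_mul_eq_mul_div,
    div_le_iff₀ hz'] at hρ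
  nlinarith

end Contraction

end

/-! ### Minima of finite families -/

section PiecewiseQuadratic

variable {n : ℕ}

/-- A form that is nowhere strictly below all the others can be erased without changing the minimum;
induction on the index set removes all such forms. -/
theorem isPMPQF_inf' {ι : Type*} (P : ι → Matrix (Fin n) (Fin n) ℝ) (hP : ∀ j, (P j).IsSymm)
    (S : Finset ι) (hS : S.Nonempty) : IsPMPQF fun x => S.inf' hS fun j => quadForm (P j) x := by
  classical
  induction S using Finset.strongInduction with
  | H S ih =>
    by_cases hirr : ∀ j ∈ S, ∃ x, ∀ k ∈ S, k ≠ j → quadForm (P j) x < quadForm (P k) x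
    · obtain ⟨m, hm⟩ : ∃ m, S.card = m + 1 := ⟨S.card - 1, by have := hS.card_pos; omega⟩
      let e : Fin (m + 1) ≃ S := (S.equivFinOfCardEq hm).symm
      refine ⟨m, fun j => P (e j), fun j => hP _, fun x => ?_, fun j => ?_⟩
      · apply le_antisymm
        · exact Finset.le_inf' _ _ fun j _ =>
            Finset.inf'_le (fun j => quadForm (P j) x) (e j).2
        · refine Finset.le_inf' _ _ fun j hj => ?_
          have := Finset.inf'_le (fun j => quadForm (P (e j)) x) (Finset.mem_univ (e.symm ⟨j, hj⟩))
          rwa [Equiv.apply_symm_apply] at this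
      · obtain ⟨x, hx⟩ := hirr (e j) (e j).2
        exact ⟨x, fun k hk => hx _ (e k).2 fun h => hk (e.injective (Subtype.ext h))⟩
    · push Not at hirr
      obtain ⟨j, hj, hjx⟩ := hirr
      have hne : (S.erase j).Nonempty := by
        obtain ⟨k, hk, hkj, -⟩ := hjx 0
        exact ⟨k, Finset.mem_erase.2 ⟨hkj, hk⟩⟩
      convert ih (S.erase j) (Finset.erase_ssubset hj) hne using 1
      funext x
      apply le_antisymm
      · exact Finset.inf'_mono _ (Finset.erase_subset _ _) hne
      · refine Finset.le_inf' _ _ fun i hi => ?_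
        by_cases hij : i = j
        · obtain ⟨k, hk, hkj, hle⟩ := hjx x
          subst hij
          exact (Finset.inf'_le _ (Finset.mem_erase.2 ⟨hkj, hk⟩)).trans hle
        · exact Finset.inf'_le _ (Finset.mem_erase.2 ⟨hij, hi⟩)

end PiecewiseQuadratic

section DirectionalDerivative

variable {n : ℕ} {x η : EuclideanSpace ℝ (Fin n)}

theorem HasDirDeriv.tendsto {f : EuclideanSpace ℝ (Fin n) → ℝ} {d : ℝ} (hf : HasDirDeriv f x η d) :
    Tendsto (fun s : ℝ => f (x + s • η)) (𝓝[>] 0) (𝓝 (f x)) := by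
  have hs : Tendsto (fun s : ℝ => s) (𝓝[>] 0) (𝓝 0) := nhdsWithin_le_nhds
  have h1 := (hs.mul hf).add_const (f x)
  rw [zero_mul, zero_add] at h1
  refine h1.congr' ?_
  filter_upwards [self_mem_nhdsWithin] with s hs
  have : s ≠ 0 := ne_of_gt hs
  field_simp
  ring

/-- Indices not minimal at `x` stay non-minimal for small `s`. So the quotient of the minimum is
eventually the minimum of the quotients over the set `R` of active indices. -/
theorem HasDirDeriv.inf' {ι : Type*} {S : Finset ι} (hS : S.Nonempty)
    {f : ι → EuclideanSpace ℝ (Fin n) → ℝ} {d : ι → ℝ}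
    (hf : ∀ j ∈ S, HasDirDeriv (f j) x η (d j)) :
    ∃ D, HasDirDeriv (fun y => S.inf' hS fun j => f j y) x η D ∧
      ∀ j ∈ S, f j x = S.inf' hS (fun j => f j x) → D ≤ d j := by
  classical
  set v := S.inf' hS (fun j => f j x) with hv
  set R := S.filter fun j => f j x = v with hR
  obtain ⟨i, hi, hiv⟩ := Finset.exists_mem_eq_inf' hS fun j => f j x
  have hiR : i ∈ R := Finset.mem_filter.2 ⟨hi, hiv.symm⟩
  have hRne : R.Nonempty := ⟨i, hiR⟩
  refine ⟨R.inf' hRne d, ?_, fun j hj hjv => Finset.inf'_le _ (Finset.mem_filter.2 ⟨hj, hjv⟩)⟩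
  have h1 : Tendsto (fun s : ℝ => R.inf' hRne fun j => (1 / s) * (f j (x + s • η) - f j x))
      (𝓝[>] 0) (𝓝 (R.inf' hRne d)) :=
    Tendsto.finset_inf'_nhds_apply hRne fun j hj => hf j (Finset.mem_filter.1 hj).1
  refine h1.congr' ?_
  have h2 : ∀ᶠ s : ℝ in 𝓝[>] 0, ∀ j ∈ S, f j x ≠ v → f i (x + s • η) < f j (x + s • η) := by
    rw [Filter.eventually_all_finset]
    intro j hj
    by_cases hjv : f j x = v
    · exact Eventually.of_forall fun s h => absurd hjv h
    · have hlt : f i x < f j x := by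
        rw [← hiv]
        exact lt_of_le_of_ne (Finset.inf'_le _ hj) (Ne.symm hjv)
      filter_upwards [(hf i hi).tendsto.eventually_lt (hf j hj).tendsto hlt] with s hs _ using hs
  filter_upwards [h2, self_mem_nhdsWithin] with s hs hs0
  have hs0 : 0 < s := hs0
  obtain ⟨k, hk, hkv⟩ := Finset.exists_mem_eq_inf' hS fun j => f j (x + s • η)
  have hkR : f k x = v := by
    by_contra hne
    have := hs k hk hne
    rw [← hkv] at this
    exact absurd (Finset.inf'_le _ hi) (not_le.2 this)
  have hval : ∀ j ∈ R, f j x = v := fun j hj => (Finset.mem_filter.1 hj).2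
  apply le_antisymm
  · rw [hkv, ← hv, ← hkR]
    exact Finset.inf'_le (fun j => (1 / s) * (f j (x + s • η) - f j x))
      (Finset.mem_filter.2 ⟨hk, hkR⟩)
  · refine Finset.le_inf' _ _ fun j hj => ?_
    rw [hval j hj, hv]
    gcongr
    exact Finset.inf'_le _ (Finset.mem_filter.1 hj).1

end DirectionalDerivative

/-! ### The value function as a minimum of quadratic forms -/

section Quadratic

variable {n M : ℕ} (A : Fin M → Matrix (Fin n) (Fin n) ℝ) (h : ℝ)

theorem hasDirDeriv_horizonCost (N : ℕ) (σ : ℕ → Fin M) (x η : EuclideanSpace ℝ (Fin n)) :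
    HasDirDeriv (horizonCost A h N σ) x η (∑ k ∈ Finset.range (N + 1),
      2 * inner ℝ (transition A h σ k x) (transition A h σ k η)) := by
  set b := ∑ k ∈ Finset.range (N + 1),
    2 * inner ℝ (transition A h σ k x) (transition A h σ k η) with hb
  have key : ∀ s : ℝ, horizonCost A h N σ (x + s • η)
      = horizonCost A h N σ x + s * b + s ^ 2 * horizonCost A h N σ η := by
    intro s
    simp only [horizonCost_eq, hb, Finset.mul_sum, ← Finset.sum_add_distrib]
    refine Finset.sum_congr rfl fun k _ => ?_
    rw [map_add, map_smul, norm_add_sq_real, real_inner_smul_right, norm_smul, mul_pow,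
      Real.norm_eq_abs, sq_abs]
    ring
  have hs : Tendsto (fun s : ℝ => s) (𝓝[>] 0) (𝓝 0) := nhdsWithin_le_nhds
  have h1 : Tendsto (fun s : ℝ => b + s * horizonCost A h N σ η) (𝓝[>] 0) (𝓝 b) := by
    simpa using (hs.mul_const (horizonCost A h N σ η)).const_add b
  refine h1.congr' ?_
  filter_upwards [self_mem_nhdsWithin] with s hs
  have : s ≠ 0 := ne_of_gt hs
  rw [key]
  field_simp
  ring

/-- The matrix of the transition operator. -/
def transitionMatrix (σ : ℕ → Fin M) (k : ℕ) : Matrix (Fin n) (Fin n) ℝ :=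
  (Matrix.toEuclideanCLM (n := Fin n) (𝕜 := ℝ)).symm (transition A h σ k)

theorem quadForm_transpose_mul_self (Φ : Matrix (Fin n) (Fin n) ℝ) (z : EuclideanSpace ℝ (Fin n)) :
    quadForm (Φ.transpose * Φ) z = ‖Matrix.toEuclideanCLM (n := Fin n) (𝕜 := ℝ) Φ z‖ ^ 2 := by
  rw [quadForm, ← Matrix.mulVec_mulVec, Matrix.dotProduct_mulVec, Matrix.vecMul_transpose,
    EuclideanSpace.real_norm_sq_eq]
  simp [dotProduct, sq]

theorem horizonCost_eq_quadForm (N : ℕ) (σ : ℕ → Fin M) (z : EuclideanSpace ℝ (Fin n)) :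
    horizonCost A h N σ z = quadForm (∑ k ∈ Finset.range (N + 1),
      (transitionMatrix A h σ k).transpose * transitionMatrix A h σ k) z := by
  have hsum : ∀ (s : Finset ℕ) (Q : ℕ → Matrix (Fin n) (Fin n) ℝ),
      quadForm (∑ k ∈ s, Q k) z = ∑ k ∈ s, quadForm (Q k) z := by
    intro s Q
    simp [quadForm, Matrix.sum_mulVec, dotProduct_sum]
  rw [horizonCost_eq, hsum]
  refine Finset.sum_congr rfl fun k _ => ?_
  rw [quadForm_transpose_mul_self, transitionMatrix, StarAlgEquiv.apply_symm_apply]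

theorem isPMPQF_valueFunction [NeZero M] (N : ℕ) : IsPMPQF (valueFunction A h N) := by
  have := isPMPQF_inf' (fun τ : Fin N → Fin M => ∑ k ∈ Finset.range (N + 1),
      (transitionMatrix A h (extendSignal τ) k).transpose
        * transitionMatrix A h (extendSignal τ) k) (fun τ => by
      simp [Matrix.IsSymm, Matrix.transpose_sum, Matrix.transpose_mul])
      Finset.univ Finset.univ_nonempty
  convert this using 1
  funext z
  rw [valueFunction_eq_inf']
  simp only [horizonCost_eq_quadForm]

theorem exists_hasDirDeriv_valueFunction [NeZero M] (N : ℕ) (x η : EuclideanSpace ℝ (Fin n)) :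
    ∃ D, HasDirDeriv (valueFunction A h N) x η D ∧
      ∀ τ : Fin N → Fin M, horizonCost A h N (extendSignal τ) x = valueFunction A h N x →
        D ≤ ∑ k ∈ Finset.range (N + 1), 2 * inner ℝ (transition A h (extendSignal τ) k x)
          (transition A h (extendSignal τ) k η) := by
  obtain ⟨D, hD, hle⟩ := HasDirDeriv.inf' (S := Finset.univ) Finset.univ_nonempty
    (f := fun τ : Fin N → Fin M => horizonCost A h N (extendSignal τ))
    fun τ _ => hasDirDeriv_horizonCost A h N (extendSignal τ) x η
  refine ⟨D, ?_, fun τ hτ => hle τ (Finset.mem_univ _) ?_⟩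
  · convert hD using 1
    funext y
    exact valueFunction_eq_inf' A h N y
  · rw [hτ, valueFunction_eq_inf']

end Quadratic

section

variable {n M : ℕ} {A : Fin M → Matrix (Fin n) (Fin n) ℝ} {a h : ℝ}

/-! ### Bounds along optimal sampled trajectories -/

theorem sum_norm_transition_sq_mul_le (ha0 : 0 ≤ a) (ha : ∀ i, ‖generator A i‖ ≤ a) (hh : 0 ≤ h)
    {τ : ℝ} {p m : ℕ} (hmp : m ≤ p) (hp : p * h ≤ τ) (ρ : ℕ → Fin M)
    (z : EuclideanSpace ℝ (Fin n)) :
    (∑ j ∈ Finset.range m, ‖transition A h ρ j z‖ ^ 2) * h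
      ≤ τ * Real.exp (a * τ) ^ 2 * ‖z‖ ^ 2 := by
  have hm : m * h ≤ τ := le_trans (by gcongr) hp
  have h1 : ∀ j ∈ Finset.range m, ‖transition A h ρ j z‖ ^ 2 ≤ (Real.exp (a * τ) * ‖z‖) ^ 2 := by
    intro j hj
    have hjm : (j : ℝ) ≤ m := by exact_mod_cast (Finset.mem_range.1 hj).le
    have h2 := norm_transition_apply_le ha hh ρ j z
    have h3 : Real.exp (a * (j * h)) ≤ Real.exp (a * τ) :=
      Real.exp_le_exp.2 (mul_le_mul_of_nonneg_left (le_trans (by gcongr) hm) ha0)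
    gcongr
    exact h2.trans (by gcongr)
  calc (∑ j ∈ Finset.range m, ‖transition A h ρ j z‖ ^ 2) * h
      ≤ (∑ j ∈ Finset.range m, (Real.exp (a * τ) * ‖z‖) ^ 2) * h := by
        exact mul_le_mul_of_nonneg_right (Finset.sum_le_sum h1) hh
    _ = (m * h) * (Real.exp (a * τ) * ‖z‖) ^ 2 := by
        rw [Finset.sum_const, Finset.card_range, nsmul_eq_mul]; ring
    _ ≤ τ * (Real.exp (a * τ) * ‖z‖) ^ 2 := by gcongr
    _ = _ := by ring

/-- Converts a derivative into a finite difference. With `F` the mode flow and `B` its generator, `F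
(h • B x)` differs from `F x - x` to second order in `h`, and `2⟨u, u - v⟩ = ‖u‖² - ‖v‖² + ‖u -
v‖²`. The constant is `4 + 2 * 8`. -/
theorem inner_modeFlow_generator_le (ha : ∀ i, ‖generator A i‖ ≤ a) (hh : 0 ≤ h)
    (ha2 : Real.exp (a * h) ≤ 2) (ha0 : 0 ≤ a) {G : ℝ}
    (Ψ : EuclideanSpace ℝ (Fin n) →L[ℝ] EuclideanSpace ℝ (Fin n)) (hG : ∀ y, ‖Ψ y‖ ≤ G * ‖y‖)
    (hG0 : 0 ≤ G) (i : Fin M) (x : EuclideanSpace ℝ (Fin n)) :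
    h * (2 * inner ℝ (Ψ (modeFlow A h i x)) (Ψ (modeFlow A h i (generator A i x))))
      ≤ ‖Ψ (modeFlow A h i x)‖ ^ 2 - ‖Ψ x‖ ^ 2 + 20 * G ^ 2 * a ^ 2 * h ^ 2 * ‖x‖ ^ 2 := by
  set F := modeFlow A h i with hF
  set B := generator A i with hB
  have h1 : ‖F x - x‖ ≤ 2 * a * h * ‖x‖ := by
    refine (norm_modeFlow_apply_sub_le ha hh i x).trans ?_
    have : a * h * Real.exp (a * h) ≤ a * h * 2 := by gcongr
    nlinarith [norm_nonneg x]
  have h2 : ‖F x‖ ≤ 2 * ‖x‖ := (norm_modeFlow_apply_le ha hh i x).trans (by gcongr)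
  have h3 : ‖h • B x‖ ≤ a * h * ‖x‖ := by
    rw [norm_smul, Real.norm_of_nonneg hh]
    have := norm_generator_apply_le ha i x
    nlinarith
  have h4 : ‖F (h • B x) - (F x - x)‖ ≤ 4 * a ^ 2 * h ^ 2 * ‖x‖ := by
    have e1 := norm_modeFlow_apply_sub_le ha hh i (h • B x)
    have e2 := norm_modeFlow_apply_sub_sub_le ha hh i x
    have e3 : F (h • B x) - (F x - x) = (F (h • B x) - h • B x) - (F x - x - h • B x) := by abel
    have e4 : a * h * Real.exp (a * h) * ‖h • B x‖ ≤ a * h * 2 * (a * h * ‖x‖) := by gcongr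
    have e5 : (a * h) ^ 2 * Real.exp (a * h) * ‖x‖ ≤ (a * h) ^ 2 * 2 * ‖x‖ := by gcongr
    rw [e3]
    refine (norm_sub_le _ _).trans ((add_le_add (e1.trans e4) (e2.trans e5)).trans_eq ?_)
    ring
  have h5 : ‖Ψ (F x - x)‖ ^ 2 ≤ 4 * G ^ 2 * a ^ 2 * h ^ 2 * ‖x‖ ^ 2 := by
    calc ‖Ψ (F x - x)‖ ^ 2 ≤ (G * (2 * a * h * ‖x‖)) ^ 2 := by
          gcongr; exact (hG _).trans (by gcongr)
      _ = _ := by ring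
  have h6 : inner ℝ (Ψ (F x)) (Ψ (F (h • B x) - (F x - x)))
      ≤ 8 * G ^ 2 * a ^ 2 * h ^ 2 * ‖x‖ ^ 2 := by
    calc inner ℝ (Ψ (F x)) (Ψ (F (h • B x) - (F x - x)))
        ≤ ‖Ψ (F x)‖ * ‖Ψ (F (h • B x) - (F x - x))‖ := real_inner_le_norm _ _
      _ ≤ (G * (2 * ‖x‖)) * (G * (4 * a ^ 2 * h ^ 2 * ‖x‖)) := by
          gcongr
          · exact (hG _).trans (by gcongr)
          · exact (hG _).trans (by gcongr)
      _ = _ := by ring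
  have h7 : h * (2 * inner ℝ (Ψ (F x)) (Ψ (F (B x)))) = ‖Ψ (F x)‖ ^ 2 - ‖Ψ x‖ ^ 2
      + ‖Ψ (F x - x)‖ ^ 2 + 2 * inner ℝ (Ψ (F x)) (Ψ (F (h • B x) - (F x - x))) := by
    simp only [map_sub, map_smul, inner_sub_right, real_inner_smul_right, norm_sub_sq_real,
      real_inner_self_eq_norm_sq]
    ring
  rw [h7]
  linarith

/-! ### Decrease along optimal modes -/

theorem optimal_dirDeriv_le (ha0 : 0 < a) (ha : ∀ i, ‖generator A i‖ ≤ a) (hh : 0 < h) {T G : ℝ}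
    (hG : G = Real.exp (a * T))
    (hhQ : h * (2 * a + 16 * a * G + 4 * (2 * a + 20 * T * G ^ 2 * a ^ 2)) ≤ 1) {N : ℕ}
    (hNT : (N + 1 : ℕ) * h ≤ T) {σ : ℕ → Fin M} {x : EuclideanSpace ℝ (Fin n)}
    (hσ : horizonCost A h (N + 1) σ x = valueFunction A h (N + 1) x)
    (hterm : ‖transition A h σ (N + 1) x‖ ≤ 1 / 8 * ‖x‖) :
    h * ∑ k ∈ Finset.range (N + 1 + 1), 2 * inner ℝ (transition A h σ k x)
          (transition A h σ k (generator A (σ 0) x)) ≤ - (1 / 2 * ‖x‖ ^ 2) := by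
  set F := modeFlow A h (σ 0) with hF
  set B := generator A (σ 0) with hB
  set Ψ := transition A h (fun l => σ (l + 1)) with hΨ
  have hT : 0 ≤ T := le_trans (by positivity) hNT
  have hG0 : 0 < G := hG ▸ Real.exp_pos _
  -- The three parts of `hhQ` give in turn `exp (a * h) ≤ 2`, a terminal perturbation of at most
  -- `‖x‖ / 8`, and a total error of at most `‖x‖² / 4`.
  have hr1 : 0 ≤ h * (2 * a) := by positivity
  have hr2 : 0 ≤ h * (16 * a * G) := by positivity
  have hr3 : 0 ≤ h * (4 * (2 * a + 20 * T * G ^ 2 * a ^ 2)) := by positivity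
  have ha2 : Real.exp (a * h) ≤ 2 := by
    have h1 := Real.add_one_le_exp (-(a * h))
    rw [Real.exp_neg] at h1
    have h2 : (1 / 2 : ℝ) ≤ (Real.exp (a * h))⁻¹ := by nlinarith
    rwa [one_div, inv_le_inv₀ two_pos (Real.exp_pos _)] at h2
  have hΨG : ∀ k ≤ N + 1, ∀ y, ‖Ψ k y‖ ≤ G * ‖y‖ := by
    intro k hk y
    refine (norm_transition_apply_le ha hh.le _ _ _).trans ?_
    rw [hG]
    gcongr
    refine le_trans ?_ hNT
    gcongr
  have hsplit : ∑ k ∈ Finset.range (N + 1 + 1), 2 * inner ℝ (transition A h σ k x)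
        (transition A h σ k (B x))
      = ∑ k ∈ Finset.range (N + 1), 2 * inner ℝ (Ψ k (F x)) (Ψ k (F (B x)))
        + 2 * inner ℝ x (B x) := by
    rw [Finset.sum_range_succ']
    simp only [transition_succ_apply', transition_zero_apply]
    rfl
  have hcost : valueFunction A h (N + 1) x
      = ∑ k ∈ Finset.range (N + 1), ‖Ψ k (F x)‖ ^ 2 + ‖x‖ ^ 2 := by
    rw [← hσ, horizonCost_eq, Finset.sum_range_succ']
    simp only [transition_succ_apply', transition_zero_apply]
    rfl
  -- Optimality enters here: the competitor skips the first mode and takes one extra step at the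
  -- end.
  have hsub : valueFunction A h (N + 1) x
      ≤ ∑ k ∈ Finset.range (N + 1), ‖Ψ k x‖ ^ 2 + ‖Ψ (N + 1) x‖ ^ 2 := by
    refine (valueFunction_le A h (N + 1) (fun l => σ (l + 1)) x).trans_eq ?_
    rw [horizonCost_eq, Finset.sum_range_succ]
  have hlast : ‖Ψ (N + 1) x‖ ^ 2 ≤ 1 / 4 * ‖x‖ ^ 2 := by
    have e1 : ‖Ψ N (F x)‖ ≤ 1 / 8 * ‖x‖ := by
      rw [transition_succ_apply'] at hterm
      exact hterm
    have e2 : ‖F x - x‖ ≤ a * h * 2 * ‖x‖ :=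
      (norm_modeFlow_apply_sub_le ha hh.le _ x).trans (by gcongr)
    have e3 : ‖Ψ N (F x - x)‖ ≤ 1 / 8 * ‖x‖ := by
      calc ‖Ψ N (F x - x)‖ ≤ G * (a * h * 2 * ‖x‖) :=
            (hΨG N N.le_succ _).trans (by gcongr)
        _ = (h * (16 * a * G)) * (1 / 8 * ‖x‖) := by ring
        _ ≤ 1 * (1 / 8 * ‖x‖) := by gcongr; linarith
        _ = _ := one_mul _
    have e4 : ‖Ψ N x‖ ≤ 1 / 4 * ‖x‖ := by
      have := norm_sub_le (Ψ N (F x)) (Ψ N (F x - x))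
      rw [map_sub, sub_sub_cancel, ← map_sub] at this
      linarith
    have e5 : ‖Ψ (N + 1) x‖ ≤ 2 * (1 / 4 * ‖x‖) := by
      rw [hΨ, transition_succ_apply]
      exact (norm_modeFlow_apply_le ha hh.le _ _).trans (by gcongr)
    calc ‖Ψ (N + 1) x‖ ^ 2 ≤ (2 * (1 / 4 * ‖x‖)) ^ 2 := by gcongr
      _ = _ := by ring
  have hsum : h * ∑ k ∈ Finset.range (N + 1), 2 * inner ℝ (Ψ k (F x)) (Ψ k (F (B x)))
      ≤ ∑ k ∈ Finset.range (N + 1), ‖Ψ k (F x)‖ ^ 2 - ∑ k ∈ Finset.range (N + 1), ‖Ψ k x‖ ^ 2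
        + h * (20 * T * G ^ 2 * a ^ 2) * ‖x‖ ^ 2 := by
    rw [Finset.mul_sum]
    have e1 := Finset.sum_le_sum fun k (hk : k ∈ Finset.range (N + 1)) =>
      inner_modeFlow_generator_le ha hh.le ha2 ha0.le (Ψ k)
        (hΨG k (Finset.mem_range.1 hk).le) hG0.le (σ 0) x
    refine e1.trans ?_
    rw [Finset.sum_add_distrib, Finset.sum_sub_distrib, Finset.sum_const, Finset.card_range,
      nsmul_eq_mul]
    refine add_le_add le_rfl ?_
    calc ((N + 1 : ℕ) : ℝ) * (20 * G ^ 2 * a ^ 2 * h ^ 2 * ‖x‖ ^ 2)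
        = ((N + 1 : ℕ) * h) * (20 * G ^ 2 * a ^ 2 * h * ‖x‖ ^ 2) := by ring
      _ ≤ T * (20 * G ^ 2 * a ^ 2 * h * ‖x‖ ^ 2) := by gcongr
      _ = _ := by ring
  have hxB : inner ℝ x (B x) ≤ a * ‖x‖ ^ 2 := by
    have e1 := real_inner_le_norm x (B x)
    have e2 := norm_generator_apply_le ha (σ 0) x
    nlinarith [norm_nonneg x]
  have hsmall : h * (2 * a + 20 * T * G ^ 2 * a ^ 2) * ‖x‖ ^ 2 ≤ 1 / 4 * ‖x‖ ^ 2 := by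
    gcongr
    linarith
  have hxB' := mul_le_mul_of_nonneg_left hxB hh.le
  rw [hsplit, mul_add]
  nlinarith

/-! ### Growth of the value function and terminal states -/

variable [NeZero M]

/-- Each contraction block quarters the squared norm, so block costs are dominated by a geometric
series of sum `4 / 3`. The condition `1 ≤ p` makes the induction descend. -/
theorem valueFunction_mul_le (ha0 : 0 ≤ a) (ha : ∀ i, ‖generator A i‖ ≤ a) (hh : 0 < h) {τ : ℝ}
    (hc : ∀ z : EuclideanSpace ℝ (Fin n), ∃ p : ℕ, 1 ≤ p ∧ p * h ≤ τ ∧ ∃ ρ : ℕ → Fin M,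
        ‖transition A h ρ p z‖ ≤ 1 / 2 * ‖z‖) (N : ℕ) (z : EuclideanSpace ℝ (Fin n)) :
    valueFunction A h N z * h ≤ 4 / 3 * (τ * Real.exp (a * τ) ^ 2) * ‖z‖ ^ 2 := by
  induction N using Nat.strong_induction_on generalizing z with
  | _ N ih =>
    obtain ⟨p, hp, hpτ, ρ, hρ⟩ := hc z
    have hτ : 0 ≤ τ := le_trans (by positivity) hpτ
    have hC : 0 ≤ τ * Real.exp (a * τ) ^ 2 := by positivity
    rcases lt_or_ge N p with hN | hN
    · have h1 := sum_norm_transition_sq_mul_le ha0 ha hh.le (show N + 1 ≤ p from hN) hpτ ρ z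
      rw [← horizonCost_eq] at h1
      have h2 := mul_le_mul_of_nonneg_right (valueFunction_le A h N ρ z) hh.le
      nlinarith [mul_nonneg hC (sq_nonneg ‖z‖)]
    · obtain ⟨m, rfl⟩ := Nat.exists_eq_add_of_le hN
      have h1 := sum_norm_transition_sq_mul_le ha0 ha hh.le le_rfl hpτ ρ z
      have h2 := mul_le_mul_of_nonneg_right (valueFunction_add_le A h p m ρ z) hh.le
      have h3 := ih m (by omega) (transition A h ρ p z)
      have h4 : ‖transition A h ρ p z‖ ^ 2 ≤ 1 / 4 * ‖z‖ ^ 2 := by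
        calc ‖transition A h ρ p z‖ ^ 2 ≤ (1 / 2 * ‖z‖) ^ 2 := by gcongr
          _ = _ := by ring
      have h5 := mul_le_mul_of_nonneg_left h4 hC
      linarith

/-- By averaging, some state `x k` before the final unit of time has squared norm at most `K‖z‖² /
(N * h - 1)`. The tail from `x k` is optimal, so its cost is of order `‖x k‖² / h`. The last state
cannot be large, since all states in the final unit of time would then be large too. -/
theorem norm_terminal_le (ha0 : 0 ≤ a) (ha : ∀ i, ‖generator A i‖ ≤ a) (hh : 0 < h)
    {K : ℝ} (hK : 0 < K) (hV : ∀ N z, valueFunction A h N z * h ≤ K * ‖z‖ ^ 2) {N : ℕ}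
    (hN : 2 + 64 * (K ^ 2 * Real.exp a ^ 2) ≤ N * h) {σ : ℕ → Fin M}
    {z : EuclideanSpace ℝ (Fin n)} (hσ : horizonCost A h N σ z = valueFunction A h N z) :
    ‖transition A h σ N z‖ ≤ 1 / 8 * ‖z‖ := by
  set x := fun k => transition A h σ k z with hx
  set w := ⌊1 / h⌋₊ with hw
  have hc0 : 0 < K ^ 2 * Real.exp a ^ 2 := by positivity
  have hw1 : w * h ≤ 1 := (le_div_iff₀ hh).1 (Nat.floor_le (by positivity))
  have hw2 : 1 ≤ (w + 1) * h := (div_le_iff₀ hh).1 (Nat.lt_floor_add_one _).le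
  have hwN : w ≤ N := by
    have : (w : ℝ) * h ≤ N * h := by linarith
    exact_mod_cast le_of_mul_le_mul_right this hh
  obtain ⟨q, hq⟩ := Nat.exists_eq_add_of_le' hwN
  obtain ⟨k, hk, hmin⟩ := Finset.exists_min_image (Finset.range (q + 1)) (fun k => ‖x k‖ ^ 2)
    ⟨0, by simp⟩
  have hkq : k ≤ q := Nat.lt_succ_iff.1 (Finset.mem_range.1 hk)
  obtain ⟨d, hd⟩ := Nat.exists_eq_add_of_le hkq
  have hNk : N = k + (d + w) := by omega
  have hqN : (q : ℝ) + w = N := by rw [hq]; push_cast; ring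
  have h1 : (N * h - 1) * ‖x k‖ ^ 2 ≤ K * ‖z‖ ^ 2 := by
    have e1 : (q + 1 : ℝ) * ‖x k‖ ^ 2 ≤ ∑ j ∈ Finset.range (q + 1), ‖x j‖ ^ 2 := by
      have := Finset.card_nsmul_le_sum _ _ _ hmin
      simpa using this
    have e2 : ∑ j ∈ Finset.range (q + 1), ‖x j‖ ^ 2 ≤ ∑ j ∈ Finset.range (N + 1), ‖x j‖ ^ 2 :=
      Finset.sum_le_sum_of_subset_of_nonneg (Finset.range_subset_range.2 (by omega))
        fun _ _ _ => sq_nonneg _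
    have e3 : ∑ j ∈ Finset.range (N + 1), ‖x j‖ ^ 2 = valueFunction A h N z := by
      rw [← hσ, horizonCost_eq]
    have e4 := hV N z
    have e5 : N * h - 1 ≤ (q + 1) * h := by nlinarith
    calc (N * h - 1) * ‖x k‖ ^ 2 ≤ (q + 1) * h * ‖x k‖ ^ 2 := by gcongr
      _ = (q + 1) * ‖x k‖ ^ 2 * h := by ring
      _ ≤ valueFunction A h N z * h := by
        rw [← e3]; exact mul_le_mul_of_nonneg_right (e1.trans e2) hh.le
      _ ≤ _ := e4
  have h2 : ‖x N‖ ^ 2 ≤ Real.exp a ^ 2 * K * ‖x k‖ ^ 2 := by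
    rw [hNk] at hσ
    have e1 := tail_le_valueFunction A h k (d + w) hσ
    rw [add_assoc, Finset.sum_range_add] at e1
    have e2 : 0 ≤ ∑ j ∈ Finset.range d, ‖transition A h σ (k + j) z‖ ^ 2 :=
      Finset.sum_nonneg fun _ _ => sq_nonneg _
    have e3 : ∀ j ∈ Finset.range (w + 1),
        ‖x N‖ ^ 2 ≤ Real.exp a ^ 2 * ‖transition A h σ (k + (d + j)) z‖ ^ 2 := by
      intro j hj
      have hjw : j ≤ w := Nat.lt_succ_iff.1 (Finset.mem_range.1 hj)
      obtain ⟨l, hl⟩ := Nat.exists_eq_add_of_le hjw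
      have e4 : N = (k + (d + j)) + l := by omega
      have hlw : (l : ℝ) ≤ w := by exact_mod_cast (show l ≤ w by omega)
      rw [← mul_pow]
      gcongr
      simp only [hx]
      rw [e4, transition_add_apply]
      refine (norm_transition_apply_le ha hh.le _ _ _).trans ?_
      gcongr
      have : l * h ≤ 1 := le_trans (by gcongr) hw1
      nlinarith
    have e5 := Finset.sum_le_sum e3
    rw [Finset.sum_const, Finset.card_range, nsmul_eq_mul, ← Finset.mul_sum] at e5
    push_cast at e5
    have e6 := hV (d + w) (x k)
    calc ‖x N‖ ^ 2 ≤ ((w + 1) * h) * ‖x N‖ ^ 2 := le_mul_of_one_le_left (sq_nonneg _) hw2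
      _ = ((w + 1) * ‖x N‖ ^ 2) * h := by ring
      _ ≤ (Real.exp a ^ 2 * valueFunction A h (d + w) (x k)) * h := by
        refine mul_le_mul_of_nonneg_right (e5.trans ?_) hh.le
        gcongr
        linarith
      _ = Real.exp a ^ 2 * (valueFunction A h (d + w) (x k) * h) := by ring
      _ ≤ Real.exp a ^ 2 * (K * ‖x k‖ ^ 2) := by gcongr
      _ = _ := by ring
  have h3 : 64 * ‖x N‖ ^ 2 ≤ ‖z‖ ^ 2 := by
    have e1 : (N * h - 1) * ‖x N‖ ^ 2 ≤ K ^ 2 * Real.exp a ^ 2 * ‖z‖ ^ 2 := by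
      calc (N * h - 1) * ‖x N‖ ^ 2
          ≤ (N * h - 1) * (Real.exp a ^ 2 * K * ‖x k‖ ^ 2) := by
            refine mul_le_mul_of_nonneg_left h2 ?_
            linarith
        _ = Real.exp a ^ 2 * K * ((N * h - 1) * ‖x k‖ ^ 2) := by ring
        _ ≤ Real.exp a ^ 2 * K * (K * ‖z‖ ^ 2) := by gcongr
        _ = _ := by ring
    have e2 : (64 * (K ^ 2 * Real.exp a ^ 2)) * ‖x N‖ ^ 2 ≤ (N * h - 1) * ‖x N‖ ^ 2 := by
      refine mul_le_mul_of_nonneg_right ?_ (sq_nonneg _)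
      linarith
    refine le_of_mul_le_mul_left ?_ hc0
    linarith
  refine le_of_sq_le_sq ?_ (by positivity)
  calc ‖x N‖ ^ 2 ≤ 1 / 64 * ‖z‖ ^ 2 := by linarith
    _ = _ := by ring

/-! ### The value function as a control-Lyapunov function -/

theorem isPMPQCLF_of_decrease (hh : 0 < h) {N : ℕ}
    (hdec : ∀ x : EuclideanSpace ℝ (Fin n), ∃ (τ : Fin N → Fin M) (i : Fin M),
      horizonCost A h N (extendSignal τ) x = valueFunction A h N x ∧
      h * ∑ k ∈ Finset.range (N + 1), 2 * inner ℝ (transition A h (extendSignal τ) k x)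
          (transition A h (extendSignal τ) k (generator A i x)) ≤ - (1 / 2 * ‖x‖ ^ 2)) :
    IsPMPQCLF A (valueFunction A h N) := by
  have hV := norm_sq_le_valueFunction A h N
  refine ⟨isPMPQF_valueFunction A h N, fun x => (sq_nonneg _).trans (hV x),
    fun x => 1 / (2 * h) * ‖x‖ ^ 2, by fun_prop, fun x => by positivity, fun x hx => ?_,
    valueFunction_zero A h N, fun β => ?_, fun x => ?_⟩
  · have : 0 < ‖x‖ := norm_pos_iff.2 hx
    exact ⟨lt_of_lt_of_le (by positivity) (hV x), by positivity⟩
  · refine isBounded_iff_forall_norm_le.2 ⟨β + 1, fun x hx => ?_⟩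
    have h1 : ‖x‖ ^ 2 ≤ β := (hV x).trans hx
    nlinarith [sq_nonneg (‖x‖ - 1)]
  · choose d hd hle using fun i : Fin M =>
      exists_hasDirDeriv_valueFunction A h N x (Matrix.toEuclideanLin (A i) x)
    refine ⟨d, hd, ?_⟩
    obtain ⟨τ, i, hτ, hi⟩ := hdec x
    refine (Finset.inf'_le d (Finset.mem_univ i)).trans ((hle i τ hτ).trans ?_)
    have h2 : (∑ k ∈ Finset.range (N + 1), 2 * inner ℝ (transition A h (extendSignal τ) k x)
          (transition A h (extendSignal τ) k (generator A i x))) ≤ - (1 / 2 * ‖x‖ ^ 2) / h := by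
      rw [le_div_iff₀ hh, mul_comm]
      exact hi
    refine h2.trans_eq ?_
    field_simp

theorem SwitchingStabilizable.exists_isPMPQCLF_valueFunction (hA : SwitchingStabilizable A) :
    ∃ T₀ : ℝ, 0 < T₀ ∧ ∀ T : ℝ, T₀ ≤ T → ∃ h₀ : ℝ, 0 < h₀ ∧ ∀ h : ℝ, 0 < h → h < h₀ →
      ∀ N : ℕ, T₀ ≤ N * h → N * h ≤ T → IsPMPQCLF A (valueFunction A h N) := by
  obtain ⟨a, ha0, ha⟩ := exists_generator_bound A
  obtain ⟨τ, h₁, hτ, hh₁, hc⟩ := hA.exists_uniform_contraction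
  set K := 4 / 3 * (τ * Real.exp (a * τ) ^ 2) with hK
  have hK0 : 0 < K := by positivity
  refine ⟨2 + 64 * (K ^ 2 * Real.exp a ^ 2), by positivity, fun T hT => ?_⟩
  have hT0 : 0 < T := lt_of_lt_of_le (by positivity) hT
  set G := Real.exp (a * T) with hG
  have hG0 : 0 < G := Real.exp_pos _
  set Q := 2 * a + 16 * a * G + 4 * (2 * a + 20 * T * G ^ 2 * a ^ 2) with hQ
  have hQ0 : 0 < Q := by positivity
  refine ⟨min h₁ (1 / Q), by positivity, fun h hh hhlt N hN1 hN2 => ?_⟩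
  have hhh₁ : h < h₁ := hhlt.trans_le (min_le_left _ _)
  have hhQ : h * Q ≤ 1 :=
    (le_div_iff₀ hQ0).1 (hhlt.le.trans (min_le_right _ _))
  obtain ⟨m, rfl⟩ : ∃ m, N = m + 1 := by
    refine Nat.exists_eq_succ_of_ne_zero ?_
    rintro rfl
    have : 0 < K ^ 2 * Real.exp a ^ 2 := by positivity
    simp only [Nat.cast_zero, zero_mul] at hN1
    linarith
  refine isPMPQCLF_of_decrease hh fun x => ?_
  obtain ⟨ρ, hρ⟩ := exists_optimal A h (m + 1) x
  -- The decreasing mode is the first one of an optimal sequence; as `N = m + 1`, it is a true entry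
  -- and not the default.
  exact ⟨ρ, extendSignal ρ 0, hρ, optimal_dirDeriv_le ha0 ha hh hG hhQ hN2 hρ
    (norm_terminal_le ha0.le ha hh hK0 (valueFunction_mul_le ha0.le ha hh (hc h hh hhh₁))
      hN1 hρ)⟩

end

end SwitchedLinear

end

theorem mainTheorem2 {n M : ℕ} [NeZero M] (A : Fin M → Matrix (Fin n) (Fin n) ℝ)
    (hA : SwitchedLinear.SwitchingStabilizable A) :
    (∃ V : EuclideanSpace ℝ (Fin n) → ℝ, SwitchedLinear.IsPMPQCLF A V) ∧
    ∃ T₀ : ℝ, 0 < T₀ ∧ ∀ T : ℝ, T₀ ≤ T → ∃ h₀ : ℝ, 0 < h₀ ∧ ∀ h : ℝ, 0 < h → h < h₀ →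
      ∀ N : ℕ, T₀ ≤ N * h → N * h ≤ T →
        SwitchedLinear.IsPMPQCLF A (SwitchedLinear.valueFunction A h N) := by
  obtain ⟨T₀, hT₀, H⟩ := hA.exists_isPMPQCLF_valueFunction
  refine ⟨?_, T₀, hT₀, H⟩
  obtain ⟨h₀, hh₀, H'⟩ := H T₀ le_rfl
  -- With `h = T₀ / N` the horizon `N * h` equals `T₀` exactly, and `N > T₀ / h₀` makes `h < h₀`.
  obtain ⟨N, hN⟩ := exists_nat_gt (T₀ / h₀)
  have hN0 : (0 : ℝ) < N := lt_trans (by positivity) hN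
  have hmul : (N : ℝ) * (T₀ / N) = T₀ := by field_simp
  exact ⟨_, H' (T₀ / N) (by positivity) ((div_lt_comm₀ hh₀ hN0).1 hN) N hmul.ge hmul.le⟩
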